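/- Let $e_1,\dots,e_4$ be the standard basis of the lattice $N=\mathbb{Z}^4$, let $M=\operatorname{Hom}(N,\mathbb{Z})$, and let $$A=\{e_1,\ e_2,\ e_3+e_4,\ e_3-e_4,\ e_1+e_2-e_3,\ e_1-e_2+e_3,\ -e_1+e_2+e_3\}.$$ Let $\Sigma$ be a fan in $N_{\mathbb{R}}=\mathbb{R}^4$ (a nonempty finite collection of strongly convex rational polyhedral cones, closed under taking faces, any two of which meet in a common face; completeness is not required), and write $\Sigma(1)\subset N$ for the set of primitive generators of its one-dimensional cones. Assume that $\Sigma(1)$ agrees with $A$ up to signs: every $v\in\Sigma(1)$ satisfies $v\in A$ or $-v\in A$, and every $v\in A$ satisfies $v\in\Sigma(1)$ or $-v\in\Sigma(1)$. (For example, $\Sigma(1)=A$ or $\Sigma(1)=A\cup -A$.) Let $k$ be a field and let $X=X(\Sigma)$ be the toric variety over $k$ glued from the charts $U_\sigma=\operatorname{Spec} k[\sigma^\vee\cap M]$, $\sigma\in\Sigma$. Then: 1. $\Sigma(1)$ is $2$-regular: for every maximal linearly independent subset $B\subseteq\Sigma(1)$, the quotient $N/\langle B\rangle$ is annihilated by $2$.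 2. $X$ is not diagonally split at any integer $q\ge 2$. Here, for $q\ge 2$, let $F\colon X\to X$ be the morphism over $k$ induced by multiplication by $q$ on $N$ (so $F^{\#}(x^u)=x^{qu}$ on each chart), and let $F\times F$ be the corresponding endomorphism of $X\times_k X$. One says that $X$ is diagonally split at $q$ if there is an $\mathcal{O}_{X\times X}$-linear map $\pi\colon (F\times F)_*\mathcal{O}_{X\times X}\to\mathcal{O}_{X\times X}$ such that $\pi\circ (F\times F)^{\#}$ is the identity of $\mathcal{O}_{X\times X}$ and $\pi$ maps $(F\times F)_*I_\Delta$ into $I_\Delta$, where $I_\Delta$ is the ideal sheaf of the diagonal in $X\times_k X$. -/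

import Mathlib

open CategoryTheory CategoryTheory.Limits AlgebraicGeometry

universe u

namespace ToricSplit

noncomputable section

/-! ### Fans -/

/-- The pairing `⟨m, x⟩` of `m ∈ M = Hom(ℤⁿ, ℤ) = ℤⁿ` with `x ∈ N_ℝ = ℝⁿ`. -/
def pairing {n : ℕ} (m : Fin n → ℤ) (x : Fin n → ℝ) : ℝ :=
  ∑ i, (m i : ℝ) * x i

/-- The image in `N_ℝ = ℝⁿ` of a lattice vector `v ∈ N = ℤⁿ`. -/
def toReal {n : ℕ} (v : Fin n → ℤ) : Fin n → ℝ := fun i => (v i : ℝ)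

/-- `τ` is a face of `σ`: `τ = σ ∩ m^⊥` for some `m ∈ M` that is nonnegative on `σ`.
For rational polyhedral cones `m ∈ M` and `m ∈ M_ℝ` give the same faces. -/
def IsFace {n : ℕ} (τ σ : PointedCone ℝ (Fin n → ℝ)) : Prop :=
  ∃ m : Fin n → ℤ, (∀ x ∈ σ, 0 ≤ pairing m x) ∧ ∀ x, x ∈ τ ↔ x ∈ σ ∧ pairing m x = 0

/-- A fan in `N_ℝ = ℝⁿ` with respect to the lattice `N = ℤⁿ`: a nonempty finite collection of
strongly convex rational polyhedral cones, closed under taking faces, any two of which meet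
in a common face. The fan is not required to be complete. -/
structure Fan (n : ℕ) where
  cones : Set (PointedCone ℝ (Fin n → ℝ))
  finite : cones.Finite
  nonempty : cones.Nonempty
  rational : ∀ σ ∈ cones, ∃ s : Finset (Fin n → ℤ), σ = PointedCone.hull ℝ (toReal '' (s : Set _))
  salient : ∀ σ ∈ cones, ∀ x ∈ σ, -x ∈ σ → x = 0
  face_mem : ∀ σ ∈ cones, ∀ τ, IsFace τ σ → τ ∈ cones
  inter_face : ∀ σ ∈ cones, ∀ τ ∈ cones, IsFace (σ ⊓ τ) σ

/-- A lattice vector is primitive if it is not a multiple `d • w` of a lattice vector `w`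
with `d ≠ ±1`. In particular it is nonzero. -/
def IsPrimitive {n : ℕ} (v : Fin n → ℤ) : Prop :=
  ∀ (d : ℤ) (w : Fin n → ℤ), v = d • w → IsUnit d

/-- The set `Σ(1)` of primitive generators of the one-dimensional cones of a fan. -/
def Fan.rays {n : ℕ} (S : Fan n) : Set (Fin n → ℤ) :=
  {v | IsPrimitive v ∧ PointedCone.hull ℝ {toReal v} ∈ S.cones}

/-- A configuration `A ⊆ N = ℤⁿ` is `k`-regular if for every maximal linearly independent subset
`B` of `A` the quotient `N / ⟨B⟩` is `k`-torsion, that is, annihilated by `k`. -/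
def IsKRegular {n : ℕ} (k : ℕ) (A : Set (Fin n → ℤ)) : Prop :=
  ∀ B : Set (Fin n → ℤ), Maximal (fun C => C ⊆ A ∧ LinearIndepOn ℤ id C) B →
    ∀ x : (Fin n → ℤ) ⧸ Submodule.span ℤ B, k • x = 0

/-! ### The toric variety of a fan -/

/-- The monoid `σ^∨ ∩ M`. -/
def dualMonoid {n : ℕ} (σ : PointedCone ℝ (Fin n → ℝ)) : AddSubmonoid (Fin n → ℤ) where
  carrier := {m | ∀ x ∈ σ, 0 ≤ pairing m x}
  zero_mem' := by
    intro x _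
    simp [pairing]
  add_mem' := by
    intro a b ha hb x hx
    have h : pairing (a + b) x = pairing a x + pairing b x := by
      simp [pairing, add_mul, Finset.sum_add_distrib]
    rw [h]
    exact add_nonneg (ha x hx) (hb x hx)

lemma dualMonoid_anti {n : ℕ} {σ τ : PointedCone ℝ (Fin n → ℝ)} (h : τ ≤ σ) :
    dualMonoid σ ≤ dualMonoid τ :=
  fun _ hm x hx => hm x (h hx)

/-- The semigroup ring `k[σ^∨ ∩ M]`. -/
abbrev coneRing (k : Type u) [Field k] {n : ℕ} (σ : PointedCone ℝ (Fin n → ℝ)) : Type u :=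
  AddMonoidAlgebra k (dualMonoid σ)

/-- The inclusion `k[σ^∨ ∩ M] → k[τ^∨ ∩ M]` for `τ ⊆ σ`. -/
def coneRingMap (k : Type u) [Field k] {n : ℕ} {σ τ : PointedCone ℝ (Fin n → ℝ)} (h : τ ≤ σ) :
    coneRing k σ →+* coneRing k τ :=
  AddMonoidAlgebra.mapDomainRingHom k (AddSubmonoid.inclusion (dualMonoid_anti h))

lemma pairing_add_left {n : ℕ} (a b : Fin n → ℤ) (x : Fin n → ℝ) :
    pairing (a + b) x = pairing a x + pairing b x := by
  simp [pairing, add_mul, Finset.sum_add_distrib]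

lemma pairing_neg_left {n : ℕ} (a : Fin n → ℤ) (x : Fin n → ℝ) :
    pairing (-a) x = -pairing a x := by
  simp [pairing]

lemma pairing_nsmul_left {n : ℕ} (N : ℕ) (a : Fin n → ℤ) (x : Fin n → ℝ) :
    pairing (N • a) x = N * pairing a x := by
  simp [pairing, Finset.mul_sum, mul_assoc]

lemma pairing_toReal {n : ℕ} (m v : Fin n → ℤ) :
    pairing m (toReal v) = ((∑ i, m i * v i : ℤ) : ℝ) := by
  simp [pairing, toReal]

lemma IsFace.le {n : ℕ} {τ σ : PointedCone ℝ (Fin n → ℝ)} (h : IsFace τ σ) : τ ≤ σ := by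
  obtain ⟨m, -, hm⟩ := h
  exact fun x hx => ((hm x).1 hx).1

lemma mem_dualMonoid_hull {n : ℕ} (s : Set (Fin n → ℝ)) (m : Fin n → ℤ)
    (h : ∀ v ∈ s, 0 ≤ pairing m v) : m ∈ dualMonoid (PointedCone.hull ℝ s) := by
  intro x hx
  induction hx using Submodule.span_induction with
  | mem x hx => exact h x hx
  | zero => simp [pairing]
  | add x y _ _ hx hy =>
    have : pairing m (x + y) = pairing m x + pairing m y := by
      simp [pairing, mul_add, Finset.sum_add_distrib]
    rw [this]
    exact add_nonneg hx hy
  | smul a x _ hx =>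
    have : pairing m (a • x) = (a : ℝ) * pairing m x := by
      simp only [pairing, Finset.mul_sum]
      refine Finset.sum_congr rfl fun i _ => ?_
      have : (a • x) i = (a : ℝ) * x i := rfl
      rw [this]
      ring
    rw [this]
    exact mul_nonneg a.2 hx

/-- If `m` cuts out the face `τ` of the rational cone `σ`, every element of `τ^∨ ∩ M` is moved
into `σ^∨ ∩ M` by adding a large multiple of `m`. -/
lemma exists_add_nsmul_mem {n : ℕ} {τ σ : PointedCone ℝ (Fin n → ℝ)}
    (hσ : ∃ s : Finset (Fin n → ℤ), σ = PointedCone.hull ℝ (toReal '' (s : Set _)))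
    {m : Fin n → ℤ} (hm : ∀ x ∈ σ, 0 ≤ pairing m x)
    (hτ : ∀ x, x ∈ τ ↔ x ∈ σ ∧ pairing m x = 0) {w : Fin n → ℤ} (hw : w ∈ dualMonoid τ) :
    ∃ N : ℕ, w + N • m ∈ dualMonoid σ := by
  obtain ⟨s, rfl⟩ := hσ
  refine ⟨∑ v ∈ s, (∑ i, w i * v i).natAbs, mem_dualMonoid_hull _ _ ?_⟩
  rintro _ ⟨v, hv, rfl⟩
  have hvσ : toReal v ∈ PointedCone.hull ℝ (toReal '' (s : Set (Fin n → ℤ))) :=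
    Submodule.subset_span ⟨v, hv, rfl⟩
  have h0 := hm _ hvσ
  have hN : (∑ i, w i * v i).natAbs ≤ ∑ v ∈ s, (∑ i, w i * v i).natAbs :=
    Finset.single_le_sum (f := fun v => (∑ i, w i * v i).natAbs) (fun _ _ => Nat.zero_le _) hv
  generalize (∑ v ∈ s, (∑ i, w i * v i).natAbs) = N at hN
  rw [pairing_add_left, pairing_nsmul_left]
  by_cases hz : pairing m (toReal v) = 0
  · have := hw _ ((hτ _).2 ⟨hvσ, hz⟩)
    rw [hz]
    linarith
  · rw [pairing_toReal] at h0 hz ⊢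
    rw [pairing_toReal]
    have h1 : 0 ≤ ∑ i, m i * v i := by exact_mod_cast h0
    have h2 : ∑ i, m i * v i ≠ 0 := by exact_mod_cast hz
    generalize ∑ i, m i * v i = a at *
    generalize ∑ i, w i * v i = b at *
    have h3 : (0 : ℤ) ≤ b + N * a := by
      have : (N : ℤ) ≤ N * a := by
        have : 1 ≤ a := by omega
        nlinarith [Int.natCast_nonneg N]
      omega
    exact_mod_cast h3

lemma coneRingMap_single (k : Type u) [Field k] {n : ℕ} {σ τ : PointedCone ℝ (Fin n → ℝ)}
    (h : τ ≤ σ) (m : dualMonoid σ) (c : k) :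
    coneRingMap k h (AddMonoidAlgebra.single m c) =
      AddMonoidAlgebra.single (AddSubmonoid.inclusion (dualMonoid_anti h) m) c := by
  simp [coneRingMap]

lemma isLocalization_coneRing (k : Type u) [Field k] {n : ℕ} {τ σ : PointedCone ℝ (Fin n → ℝ)}
    (hσ : ∃ s : Finset (Fin n → ℤ), σ = PointedCone.hull ℝ (toReal '' (s : Set _)))
    {m : Fin n → ℤ} (hm : ∀ x ∈ σ, 0 ≤ pairing m x)
    (hτ : ∀ x, x ∈ τ ↔ x ∈ σ ∧ pairing m x = 0) (h : τ ≤ σ) :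
    letI := (coneRingMap k h).toAlgebra
    IsLocalization.Away (AddMonoidAlgebra.single (⟨m, hm⟩ : dualMonoid σ) (1 : k))
      (coneRing k τ) := by
  let _ := (coneRingMap k h).toAlgebra
  have halg : ∀ x, algebraMap (coneRing k σ) (coneRing k τ) x = coneRingMap k h x := fun _ => rfl
  have hneg : -m ∈ dualMonoid τ := by
    intro x hx
    rw [pairing_neg_left, ((hτ x).1 hx).2, neg_zero]
  have hpow : ∀ N : ℕ, (AddMonoidAlgebra.single (⟨m, hm⟩ : dualMonoid σ) (1 : k)) ^ N =
      AddMonoidAlgebra.single (N • (⟨m, hm⟩ : dualMonoid σ)) (1 : k) := by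
    intro N
    rw [AddMonoidAlgebra.single_pow, one_pow]
  refine IsLocalization.Away.mk _ ?_ ?_ ?_
  · rw [halg, coneRingMap_single]
    refine IsUnit.of_mul_eq_one (AddMonoidAlgebra.single (⟨-m, hneg⟩ : dualMonoid τ) (1 : k)) ?_
    rw [AddMonoidAlgebra.single_mul_single, one_mul, AddMonoidAlgebra.one_def]
    congr 1
    ext1
    simp
  · intro z
    induction z using AddMonoidAlgebra.induction_linear with
    | zero => exact ⟨0, 0, by simp⟩
    | add f g hf hg =>
      obtain ⟨N₁, a₁, h₁⟩ := hf
      obtain ⟨N₂, a₂, h₂⟩ := hg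
      refine ⟨N₁ + N₂, a₁ * (AddMonoidAlgebra.single (⟨m, hm⟩ : dualMonoid σ) (1 : k)) ^ N₂ +
        a₂ * (AddMonoidAlgebra.single (⟨m, hm⟩ : dualMonoid σ) (1 : k)) ^ N₁, ?_⟩
      rw [map_add, map_mul, map_mul, ← h₁, ← h₂, map_pow, map_pow]
      ring
    | single w c =>
      obtain ⟨N, hN⟩ := exists_add_nsmul_mem hσ hm hτ w.2
      refine ⟨N, AddMonoidAlgebra.single ⟨_, hN⟩ c, ?_⟩
      rw [← map_pow, hpow, halg, halg, coneRingMap_single, coneRingMap_single,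
        AddMonoidAlgebra.single_mul_single, mul_one]
      congr 1
  · intro a b hab
    refine ⟨0, ?_⟩
    rw [halg, halg] at hab
    have hinj : Function.Injective (AddSubmonoid.inclusion (dualMonoid_anti h)) :=
      AddSubmonoid.inclusion_injective _
    rw [AddMonoidAlgebra.mapDomain_injective hinj hab]

/-- The diagram `σ ↦ U_σ = Spec k[σ^∨ ∩ M]` over the cones of a fan ordered by inclusion. -/
def chartFunctor (k : Type u) [Field k] {n : ℕ} (S : Fan n) : S.cones ⥤ Scheme.{u} where
  obj σ := Spec (CommRingCat.of (coneRing k σ.1))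
  map {τ σ} f := Spec.map (CommRingCat.ofHom (coneRingMap k (show τ.1 ≤ σ.1 from leOfHom f)))
  map_id σ := by
    rw [← Spec.map_id, ← CommRingCat.ofHom_id]
    congr 2
    exact AddMonoidAlgebra.mapDomainRingHom_id
  map_comp {ρ τ σ} f g := by
    rw [← Spec.map_comp, ← CommRingCat.ofHom_comp]
    congr 2
    rw [coneRingMap, coneRingMap, coneRingMap, ← AddMonoidAlgebra.mapDomainRingHom_comp]
    rfl

/-- The chart inclusion `U_τ → U_σ` of a face `τ = σ ∩ m^⊥` is the open immersion onto `D(x^m)`. -/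
lemma isOpenImmersion_and_range (k : Type u) [Field k] {n : ℕ}
    {τ σ : PointedCone ℝ (Fin n → ℝ)}
    (hσ : ∃ s : Finset (Fin n → ℤ), σ = PointedCone.hull ℝ (toReal '' (s : Set _)))
    {m : Fin n → ℤ} (hm : ∀ x ∈ σ, 0 ≤ pairing m x)
    (hτ : ∀ x, x ∈ τ ↔ x ∈ σ ∧ pairing m x = 0) (h : τ ≤ σ) :
    IsOpenImmersion (Spec.map (CommRingCat.ofHom (coneRingMap k h))) ∧
      Set.range (Spec.map (CommRingCat.ofHom (coneRingMap k h))) =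
        ((PrimeSpectrum.basicOpen
          (AddMonoidAlgebra.single (⟨m, hm⟩ : dualMonoid σ) (1 : k) : coneRing k σ) :
            TopologicalSpace.Opens (PrimeSpectrum (coneRing k σ))) :
              Set (PrimeSpectrum (coneRing k σ))) := by
  let _ := (coneRingMap k h).toAlgebra
  have := isLocalization_coneRing k hσ hm hτ h
  exact ⟨IsOpenImmersion.of_isLocalization
      (AddMonoidAlgebra.single (⟨m, hm⟩ : dualMonoid σ) (1 : k) : coneRing k σ),
    PrimeSpectrum.localization_away_comap_range (coneRing k τ)
      (AddMonoidAlgebra.single (⟨m, hm⟩ : dualMonoid σ) (1 : k) : coneRing k σ)⟩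

lemma Fan.isFace_of_le {n : ℕ} (S : Fan n) {τ σ : PointedCone ℝ (Fin n → ℝ)}
    (hτ : τ ∈ S.cones) (hσ : σ ∈ S.cones) (h : τ ≤ σ) : IsFace τ σ := by
  have := S.inter_face σ hσ τ hτ
  rwa [inf_eq_right.2 h] at this

instance (k : Type u) [Field k] {n : ℕ} (S : Fan n) {τ σ : S.cones} (f : τ ⟶ σ) :
    IsOpenImmersion ((chartFunctor k S).map f) := by
  obtain ⟨m, hm, hτ⟩ := S.isFace_of_le τ.2 σ.2 (leOfHom f)
  exact (isOpenImmersion_and_range k (S.rational _ σ.2) hm hτ (leOfHom f)).1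

instance (k : Type u) [Field k] {n : ℕ} (S : Fan n) :
    (chartFunctor k S ⋙ Scheme.forget).IsLocallyDirected where
  cond {τ₁ τ₂ σ} f₁ f₂ x₁ x₂ hx := by
    obtain ⟨m₁, hm₁, hτ₁⟩ := S.isFace_of_le τ₁.2 σ.2 (leOfHom f₁)
    obtain ⟨m₂, hm₂, hτ₂⟩ := S.isFace_of_le τ₂.2 σ.2 (leOfHom f₂)
    have hm : ∀ x ∈ σ.1, 0 ≤ pairing (m₁ + m₂) x := fun x h => by
      rw [pairing_add_left]
      exact add_nonneg (hm₁ x h) (hm₂ x h)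
    have hτ : ∀ x, x ∈ τ₁.1 ⊓ τ₂.1 ↔ x ∈ σ.1 ∧ pairing (m₁ + m₂) x = 0 := fun x => by
      rw [Submodule.mem_inf, hτ₁, hτ₂, pairing_add_left]
      constructor
      · rintro ⟨⟨h, h1⟩, -, h2⟩
        exact ⟨h, by rw [h1, h2, add_zero]⟩
      · rintro ⟨h, h12⟩
        have h1 := hm₁ x h
        have h2 := hm₂ x h
        exact ⟨⟨h, by linarith⟩, h, by linarith⟩
    let ρ : S.cones := ⟨τ₁.1 ⊓ τ₂.1, S.face_mem _ σ.2 _ ⟨_, hm, hτ⟩⟩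
    let g₁ : ρ ⟶ τ₁ := homOfLE (show τ₁.1 ⊓ τ₂.1 ≤ τ₁.1 from inf_le_left)
    let g₂ : ρ ⟶ τ₂ := homOfLE (show τ₁.1 ⊓ τ₂.1 ≤ τ₂.1 from inf_le_right)
    have hrange := (isOpenImmersion_and_range k (S.rational _ σ.2) hm hτ
      (leOfHom (g₁ ≫ f₁))).2
    have hrange₁ := (isOpenImmersion_and_range k (S.rational _ σ.2) hm₁ hτ₁ (leOfHom f₁)).2
    have hrange₂ := (isOpenImmersion_and_range k (S.rational _ σ.2) hm₂ hτ₂ (leOfHom f₂)).2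
    change (chartFunctor k S).map f₁ x₁ = (chartFunctor k S).map f₂ x₂ at hx
    have hmem₁ : (chartFunctor k S).map f₁ x₁ ∈ PrimeSpectrum.basicOpen
        (AddMonoidAlgebra.single (⟨m₁, hm₁⟩ : dualMonoid σ.1) (1 : k) : coneRing k σ.1) := by
      have : (chartFunctor k S).map f₁ x₁ ∈ Set.range ((chartFunctor k S).map f₁) := ⟨_, rfl⟩
      exact hrange₁.le this
    have hmem₂ : (chartFunctor k S).map f₁ x₁ ∈ PrimeSpectrum.basicOpen
        (AddMonoidAlgebra.single (⟨m₂, hm₂⟩ : dualMonoid σ.1) (1 : k) : coneRing k σ.1) := by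
      have : (chartFunctor k S).map f₁ x₁ ∈ Set.range ((chartFunctor k S).map f₂) :=
        ⟨x₂, hx.symm⟩
      exact hrange₂.le this
    have hmem : (chartFunctor k S).map f₁ x₁ ∈ PrimeSpectrum.basicOpen
        (AddMonoidAlgebra.single (⟨m₁ + m₂, hm⟩ : dualMonoid σ.1) (1 : k) : coneRing k σ.1) := by
      have he : (AddMonoidAlgebra.single (⟨m₁ + m₂, hm⟩ : dualMonoid σ.1) (1 : k)) =
          AddMonoidAlgebra.single (⟨m₁, hm₁⟩ : dualMonoid σ.1) (1 : k) *
            AddMonoidAlgebra.single (⟨m₂, hm₂⟩ : dualMonoid σ.1) (1 : k) := by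
        rw [AddMonoidAlgebra.single_mul_single, one_mul]
        rfl
      rw [he, PrimeSpectrum.basicOpen_mul]
      exact ⟨hmem₁, hmem₂⟩
    obtain ⟨x, hx'⟩ : (chartFunctor k S).map f₁ x₁ ∈
        Set.range ((chartFunctor k S).map (g₁ ≫ f₁)) := hrange.ge hmem
    refine ⟨ρ, g₁, g₂, x, ?_, ?_⟩
    · change (chartFunctor k S).map g₁ x = x₁
      apply ((chartFunctor k S).map f₁).isOpenEmbedding.injective
      rw [← hx', Functor.map_comp, Scheme.Hom.comp_apply]
    · change (chartFunctor k S).map g₂ x = x₂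
      apply ((chartFunctor k S).map f₂).isOpenEmbedding.injective
      rw [← hx, ← hx', ← Scheme.Hom.comp_apply, ← Functor.map_comp]
      rfl

/-- The toric variety `X(Σ)` over `k`: the scheme glued from the affine charts
`U_σ = Spec k[σ^∨ ∩ M]`, `σ ∈ Σ`, along `U_τ ⊆ U_σ` for faces `τ` of `σ`. -/
def toricVariety (k : Type u) [Field k] {n : ℕ} (S : Fan n) : Scheme.{u} :=
  colimit (chartFunctor k S)

/-- The open immersion `U_σ → X(Σ)`. -/
def chart (k : Type u) [Field k] {n : ℕ} (S : Fan n) (σ : S.cones) :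
    Spec (CommRingCat.of (coneRing k σ.1)) ⟶ toricVariety k S :=
  colimit.ι (chartFunctor k S) σ

/-- The structure morphisms `U_σ → Spec k` as a cocone. -/
def structureCocone (k : Type u) [Field k] {n : ℕ} (S : Fan n) : Cocone (chartFunctor k S) where
  pt := Spec (CommRingCat.of k)
  ι :=
    { app := fun σ => Spec.map (CommRingCat.ofHom (algebraMap k (coneRing k σ.1)))
      naturality := by
        intro τ σ f
        change Spec.map _ ≫ Spec.map _ = Spec.map _ ≫ 𝟙 _
        rw [Category.comp_id, ← Spec.map_comp, ← CommRingCat.ofHom_comp]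
        congr 2
        ext c
        simp [coneRingMap] }

/-- The structure morphism `X(Σ) → Spec k`. -/
def structureMap (k : Type u) [Field k] {n : ℕ} (S : Fan n) :
    toricVariety k S ⟶ Spec (CommRingCat.of k) :=
  colimit.desc (chartFunctor k S) (structureCocone k S)

lemma chart_structureMap (k : Type u) [Field k] {n : ℕ} (S : Fan n) (σ : S.cones) :
    chart k S σ ≫ structureMap k S =
      Spec.map (CommRingCat.ofHom (algebraMap k (coneRing k σ.1))) :=
  colimit.ι_desc (structureCocone k S) σ

/-- The endomorphism of `k[σ^∨ ∩ M]` over `k` with `x^u ↦ x^(q u)`. -/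
def powerMap (k : Type u) [Field k] {n : ℕ} (q : ℕ) (σ : PointedCone ℝ (Fin n → ℝ)) :
    coneRing k σ →+* coneRing k σ :=
  AddMonoidAlgebra.mapDomainRingHom k (nsmulAddMonoidHom q)

lemma coneRingMap_comp_powerMap (k : Type u) [Field k] {n : ℕ} (q : ℕ)
    {σ τ : PointedCone ℝ (Fin n → ℝ)} (h : τ ≤ σ) :
    (coneRingMap k h).comp (powerMap k q σ) = (powerMap k q τ).comp (coneRingMap k h) := by
  rw [coneRingMap, powerMap, powerMap, ← AddMonoidAlgebra.mapDomainRingHom_comp,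
    ← AddMonoidAlgebra.mapDomainRingHom_comp]
  congr 1

/-- The endomorphisms of the charts `U_σ` induced by multiplication by `q` on `N`. -/
def chartFrob (k : Type u) [Field k] {n : ℕ} (S : Fan n) (q : ℕ) :
    chartFunctor k S ⟶ chartFunctor k S where
  app σ := Spec.map (CommRingCat.ofHom (powerMap k q σ.1))
  naturality := by
    intro τ σ f
    change Spec.map _ ≫ Spec.map _ = Spec.map _ ≫ Spec.map _
    rw [← Spec.map_comp, ← Spec.map_comp, ← CommRingCat.ofHom_comp, ← CommRingCat.ofHom_comp,
      coneRingMap_comp_powerMap]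

/-- The endomorphism `F` of `X(Σ)` induced by multiplication by `q` on `N`. -/
def frob (k : Type u) [Field k] {n : ℕ} (S : Fan n) (q : ℕ) :
    toricVariety k S ⟶ toricVariety k S :=
  colimMap (chartFrob k S q)

lemma chart_frob (k : Type u) [Field k] {n : ℕ} (S : Fan n) (q : ℕ) (σ : S.cones) :
    chart k S σ ≫ frob k S q =
      Spec.map (CommRingCat.ofHom (powerMap k q σ.1)) ≫ chart k S σ :=
  ι_colimMap (chartFrob k S q) σ

lemma frob_structureMap (k : Type u) [Field k] {n : ℕ} (S : Fan n) (q : ℕ) :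
    frob k S q ≫ structureMap k S = structureMap k S := by
  refine colimit.hom_ext fun σ => ?_
  have h : (powerMap k q σ.1).comp (algebraMap k (coneRing k σ.1)) =
      algebraMap k (coneRing k σ.1) := by
    ext c
    simp [powerMap]
  change chart k S σ ≫ frob k S q ≫ structureMap k S = chart k S σ ≫ structureMap k S
  rw [← Category.assoc, chart_frob, Category.assoc, chart_structureMap, ← Spec.map_comp,
    ← CommRingCat.ofHom_comp, h]

/-- The endomorphism `F × F` of `X × X`, that is, the one induced by multiplication by `q` on
`N × N`. -/
def frobProd (k : Type u) [Field k] {n : ℕ} (S : Fan n) (q : ℕ) :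
    pullback (structureMap k S) (structureMap k S) ⟶
      pullback (structureMap k S) (structureMap k S) :=
  pullback.map _ _ _ _ (frob k S q) (frob k S q) (𝟙 _)
    (by rw [frob_structureMap, Category.comp_id]) (by rw [frob_structureMap, Category.comp_id])

/-! ### Splittings -/

/-- The canonical `𝒪_Y`-linear map `F^# : 𝒪_Y → F_* 𝒪_Y`. -/
def sharp {Y : Scheme.{u}} (F : Y ⟶ Y) :
    (SheafOfModules.unit Y.ringCatSheaf : Y.Modules) ⟶
      (Scheme.Modules.pushforward F).obj (SheafOfModules.unit Y.ringCatSheaf : Y.Modules) :=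
  SheafOfModules.unitToPushforwardObjUnit F.toRingCatSheafHom

/-- A splitting of `Y` with respect to the endomorphism `F`: an `𝒪_Y`-linear map
`π : F_* 𝒪_Y → 𝒪_Y` such that `π ∘ F^#` is the identity of `𝒪_Y`. -/
structure Splitting {Y : Scheme.{u}} (F : Y ⟶ Y) where
  π : (Scheme.Modules.pushforward F).obj (SheafOfModules.unit Y.ringCatSheaf : Y.Modules) ⟶
    (SheafOfModules.unit Y.ringCatSheaf : Y.Modules)
  sharp_comp : sharp F ≫ π = 𝟙 _

/-- The additive map `π_U : Γ(U, F_* 𝒪_Y) = 𝒪_Y(F⁻¹(U)) → 𝒪_Y(U)` on sections. -/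
def Splitting.app {Y : Scheme.{u}} {F : Y ⟶ Y} (P : Splitting F) (U : Y.Opens) :
    Γ(Y, F ⁻¹ᵁ U) →+ Γ(Y, U) :=
  (P.π.app U).hom

/-- A splitting `π` is compatible with the closed subscheme `i : Z → Y` if `π` maps `F_* I_Z`
into `I_Z`, where `I_Z ⊆ 𝒪_Y` is the ideal sheaf of sections vanishing on `Z`, i.e. the kernel of
`i^# : 𝒪_Y → i_* 𝒪_Z`. -/
def Splitting.IsCompatible {Y Z : Scheme.{u}} {F : Y ⟶ Y} (P : Splitting F) (i : Z ⟶ Y) : Prop :=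
  ∀ (U : Y.Opens) (s : Γ(Y, F ⁻¹ᵁ U)), i.app (F ⁻¹ᵁ U) s = 0 → i.app U (P.app U s) = 0

/-- `X = X(Σ)` is diagonally split at `q`: there is a splitting at `q` of `X × X` (product over
`k`) that is compatible with the diagonal. -/
def IsDiagonallySplit (k : Type u) [Field k] {n : ℕ} (S : Fan n) (q : ℕ) : Prop :=
  ∃ P : Splitting (frobProd k S q), P.IsCompatible (pullback.diagonal (structureMap k S))

/-! ### The configuration -/

/-- The vectors `e₁`, `e₂`, `e₃ + e₄`, `e₃ - e₄`, `e₁ + e₂ - e₃`, `e₁ - e₂ + e₃`,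
`-e₁ + e₂ + e₃` in `ℤ⁴`. -/
def configuration : Set (Fin 4 → ℤ) :=
  {![1, 0, 0, 0], ![0, 1, 0, 0], ![0, 0, 1, 1], ![0, 0, 1, -1],
    ![1, 1, -1, 0], ![1, -1, 1, 0], ![-1, 1, 1, 0]}

end

end ToricSplit

/-! Non-splitting. Suppose `π` is a diagonal splitting at `q`, and take `w ∈ M`. On the torus chart
`x^(w,-w) - 1` vanishes on the diagonal, so `f = π(x^(w,-w))` restricts to `1` there. Hence `f`
contains some monomial `x^(m,-m)` with nonzero coefficient. Linearity gives `π(x^(w+qt,-w+qt')) =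
x^(t,t') f`. If the argument is regular on `U_σ × U_σ`, so is the value, which forces `m + t` and
`-m + t'` into `σ^∨`. This is `IsDiagonallySplit.exists_forall_mem_dualMonoid`. For the ray through
`v`, the best choices of `t` and `t'` yield `⌊⟨w,v⟩/q⌋ ≤ ⟨m,v⟩ ≤ ⌈⟨w,v⟩/q⌉`. Thus `u = w - qm`
satisfies `|⟨u,v⟩| < q` for all rays `v` at once (`IsDiagonallySplit.exists_forall_abs_lt`). This
condition does not see the sign of `v`, and `exists_class_without_small_representative` gives, for
each `q ≥ 2`, a class modulo `q` that violates it.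

Working on charts is legitimate because `F` pulls each `U_σ` back to itself (`frob_preimage_chart`),
so `π` becomes an additive endomorphism of each coordinate ring (`Splitting.onChart`).

Two-regularity. Signs do not affect spans, so only quadruples of the seven vectors matter. For an
independent quadruple with matrix `M`, the quotient is killed by `2` exactly when `2 M⁻¹ = 2 adj(M)
/ det M` is integral; `cofactorDet_dvd_configVec` checks this in all cases. -/

namespace ToricSplit

noncomputable section

/-! ### Splittings on sections -/

section Sections

variable {Y Z : Scheme.{u}} {F : Y ⟶ Y} (P : Splitting F)

lemma Splitting.app_mul (U : Y.Opens) (r : Γ(Y, U)) (s : Γ(Y, F ⁻¹ᵁ U)) :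
    P.app U (F.app U r * s) = r * P.app U s :=
  Scheme.Modules.Hom.app_smul P.π r s

lemma Splitting.app_one (U : Y.Opens) : P.app U 1 = 1 := by
  have h := congr(Scheme.Modules.Hom.app $P.sharp_comp U (1 : Γ(Y, U)))
  have h1 : F.app U (1 : Γ(Y, U)) = 1 := map_one _
  rw [← h1]
  exact h

lemma Splitting.app_map {U V : Y.Opens} (h : U ≤ V) (h' : F ⁻¹ᵁ U ≤ F ⁻¹ᵁ V)
    (s : Γ(Y, F ⁻¹ᵁ V)) :
    P.app U (Y.presheaf.map (homOfLE h').op s) = Y.presheaf.map (homOfLE h).op (P.app V s) :=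
  congr($(P.π.mapPresheaf.naturality (homOfLE h).op) s)

/-- The pullback of sections of `𝒪_Y` over `U` along a morphism `Spec A → U ⊆ Y`. -/
def pullSections {A : CommRingCat.{u}} (j : Spec A ⟶ Y) (U : Y.Opens) (h : ⊤ ≤ j ⁻¹ᵁ U) :
    Γ(Y, U) →+* A :=
  (j.appLE U ⊤ h ≫ (Scheme.ΓSpecIso A).hom).hom

/-- The equality `hU` is a hypothesis so that the lemma also applies to `F⁻¹(U)`, which equals the
image of `j` only propositionally. -/
lemma pullSections_bijective {A : CommRingCat.{u}} (j : Spec A ⟶ Y) [IsOpenImmersion j]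
    (U : Y.Opens) (h : ⊤ ≤ j ⁻¹ᵁ U) (hU : U = j ''ᵁ ⊤) :
    Function.Bijective (pullSections j U h) := by
  subst hU
  have : IsIso (j.appLE (j ''ᵁ ⊤) ⊤ h) := by
    rw [← j.appIso_hom' ⊤]
    infer_instance
  exact ConcreteCategory.bijective_of_isIso
    (j.appLE (j ''ᵁ ⊤) ⊤ h ≫ (Scheme.ΓSpecIso A).hom)

lemma pullSections_map {A : CommRingCat.{u}} (j : Spec A ⟶ Y) {U V : Y.Opens} (h : ⊤ ≤ j ⁻¹ᵁ U)
    (hUV : U ≤ V) (h' : ⊤ ≤ j ⁻¹ᵁ V) (s : Γ(Y, V)) :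
    pullSections j U h (Y.presheaf.map (homOfLE hUV).op s) = pullSections j V h' s := by
  have := j.map_appLE h (homOfLE hUV).op
  rw [pullSections, pullSections, ← this]
  rfl

/-- This one compatibility is used three times below: with `i` the endomorphism `F` (linearity), the
identity (restriction to a smaller chart) and the closed subscheme (compatibility). -/
lemma pullSections_app {A B : CommRingCat.{u}} (j : Spec A ⟶ Y) (l : Spec B ⟶ Z) (i : Z ⟶ Y)
    (d : A ⟶ B) (hd : Spec.map d ≫ j = l ≫ i) {U : Y.Opens} (h : ⊤ ≤ j ⁻¹ᵁ U)
    (h' : ⊤ ≤ l ⁻¹ᵁ (i ⁻¹ᵁ U)) (s : Γ(Y, U)) :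
    pullSections l (i ⁻¹ᵁ U) h' (i.app U s) = d (pullSections j U h s) := by
  have h1 : i.app U ≫ l.appLE (i ⁻¹ᵁ U) ⊤ h' = j.appLE U ⊤ h ≫ (Spec.map d).appTop := by
    have e1 := Scheme.Hom.comp_appLE l i U ⊤ h'
    have e2 := Scheme.Hom.appLE_comp_appLE (Spec.map d) j U ⊤ ⊤ h le_top
    rw [Scheme.Hom.appTop, (Spec.map d).app_eq_appLE]
    refine e1.symm.trans (Eq.trans ?_ e2.symm)
    congr 1
    exact hd.symm
  have h2 := congr($h1 ≫ (Scheme.ΓSpecIso B).hom)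
  rw [Category.assoc, Category.assoc, Scheme.ΓSpecIso_naturality] at h2
  exact congr($h2 s)

lemma le_preimage_preimage_image {A : CommRingCat.{u}} (j : Spec A ⟶ Y) [IsOpenImmersion j]
    (hF : F ⁻¹ᵁ (j ''ᵁ ⊤) = j ''ᵁ ⊤) :
    ⊤ ≤ j ⁻¹ᵁ (F ⁻¹ᵁ (j ''ᵁ ⊤)) := by
  rw [hF]
  exact (j.preimage_image_eq ⊤).ge

/-- The additive endomorphism of `A = 𝒪_Y(U)` given by a splitting, for an affine open
`U = Spec A` of `Y` with `F⁻¹(U) = U`. -/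
def Splitting.onChart {A : CommRingCat.{u}} (j : Spec A ⟶ Y) [IsOpenImmersion j]
    (hF : F ⁻¹ᵁ (j ''ᵁ ⊤) = j ''ᵁ ⊤) : A →+ A :=
  (pullSections j (j ''ᵁ ⊤) (j.preimage_image_eq ⊤).ge).toAddMonoidHom.comp <|
    (P.app (j ''ᵁ ⊤)).comp
      (RingEquiv.ofBijective (pullSections j (F ⁻¹ᵁ (j ''ᵁ ⊤))
        (le_preimage_preimage_image j hF))
        (pullSections_bijective j _ _ hF)).symm.toRingHom.toAddMonoidHom

section OnChart

variable {A B C : CommRingCat.{u}} (j : Spec A ⟶ Y) [IsOpenImmersion j]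
  (hF : F ⁻¹ᵁ (j ''ᵁ ⊤) = j ''ᵁ ⊤)

lemma Splitting.onChart_pullSections (s : Γ(Y, F ⁻¹ᵁ (j ''ᵁ ⊤))) :
    P.onChart j hF (pullSections j _ (le_preimage_preimage_image j hF) s) =
      pullSections j _ (j.preimage_image_eq ⊤).ge (P.app (j ''ᵁ ⊤) s) := by
  have := (RingEquiv.ofBijective (pullSections j (F ⁻¹ᵁ (j ''ᵁ ⊤))
    (le_preimage_preimage_image j hF)) (pullSections_bijective j _ _ hF)).symm_apply_apply s
  exact congr(pullSections j _ (j.preimage_image_eq ⊤).ge (P.app (j ''ᵁ ⊤) $this))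

lemma exists_pullSections_eq (a : A) :
    ∃ s, pullSections j _ (le_preimage_preimage_image j hF) s = a :=
  (pullSections_bijective j _ (le_preimage_preimage_image j hF) hF).2 a

lemma Splitting.onChart_one : P.onChart j hF 1 = 1 := by
  have h := P.onChart_pullSections j hF 1
  rw [P.app_one] at h
  exact (congrArg _ (map_one _)).symm.trans (h.trans (map_one _))

/-- With `φ` the ring map of `F` on the chart, this is `𝒪_Y`-linearity of `π` for the module
structure on `F_* 𝒪_Y`. -/
lemma Splitting.onChart_mul (φ : A ⟶ A) (hφ : Spec.map φ ≫ j = j ≫ F) (a b : A) :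
    P.onChart j hF (φ a * b) = a * P.onChart j hF b := by
  obtain ⟨r, rfl⟩ := (pullSections_bijective j _ (j.preimage_image_eq ⊤).ge rfl).2 a
  obtain ⟨s, rfl⟩ := exists_pullSections_eq j hF b
  rw [← pullSections_app j j F φ hφ _ (le_preimage_preimage_image j hF), ← map_mul,
    P.onChart_pullSections, P.onChart_pullSections, P.app_mul, map_mul]

lemma Splitting.onChart_restrict (j' : Spec B ⟶ Y) [IsOpenImmersion j']
    (hF' : F ⁻¹ᵁ (j' ''ᵁ ⊤) = j' ''ᵁ ⊤) (r : B ⟶ A) (hr : Spec.map r ≫ j' = j) (b : B) :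
    P.onChart j hF (r b) = r (P.onChart j' hF' b) := by
  obtain ⟨s, rfl⟩ := exists_pullSections_eq j' hF' b
  have hle : j ''ᵁ ⊤ ≤ j' ''ᵁ ⊤ := by
    rw [Scheme.Hom.image_top_eq_opensRange, Scheme.Hom.image_top_eq_opensRange]
    rintro _ ⟨x, rfl⟩
    exact ⟨Spec.map r x, by rw [← hr, Scheme.Hom.comp_apply]⟩
  have key {U V : Y.Opens} (hUV : U ≤ V) (h : ⊤ ≤ j ⁻¹ᵁ U) (h' : ⊤ ≤ j' ⁻¹ᵁ V) (t : Γ(Y, V)) :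
      r (pullSections j' V h' t) = pullSections j U h (Y.presheaf.map (homOfLE hUV).op t) := by
    have h'' : ⊤ ≤ j ⁻¹ᵁ V := h.trans (fun x hx => hUV hx)
    rw [pullSections_map j h hUV h'']
    have := pullSections_app j' j (𝟙 Y) r (by rw [hr, Category.comp_id]) h' h'' t
    rw [← this]
    rfl
  have hle' : F ⁻¹ᵁ (j ''ᵁ ⊤) ≤ F ⁻¹ᵁ (j' ''ᵁ ⊤) := fun x hx => hle hx
  rw [key hle' (le_preimage_preimage_image j hF), P.onChart_pullSections, P.onChart_pullSections,
    key hle (j.preimage_image_eq ⊤).ge, P.app_map hle hle']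

/-- Since `i⁻¹(U)` is the affine chart `Spec C`, sections of `𝒪_Z` over it are elements of `C`, so
the ideal of `Z` over `U` is the kernel of `d`. -/
lemma Splitting.onChart_compatible (i : Z ⟶ Y) (hi : P.IsCompatible i) (l : Spec C ⟶ Z)
    [IsOpenImmersion l] (d : A ⟶ C) (hd : Spec.map d ≫ j = l ≫ i)
    (hl : i ⁻¹ᵁ (j ''ᵁ ⊤) = l ''ᵁ ⊤) (a : A) (ha : d a = 0) : d (P.onChart j hF a) = 0 := by
  obtain ⟨s, rfl⟩ := exists_pullSections_eq j hF a
  have h1 : ⊤ ≤ l ⁻¹ᵁ (i ⁻¹ᵁ (j ''ᵁ ⊤)) := by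
    rw [hl]
    exact (l.preimage_image_eq ⊤).ge
  have h2 : ⊤ ≤ l ⁻¹ᵁ (i ⁻¹ᵁ (F ⁻¹ᵁ (j ''ᵁ ⊤))) := by rwa [hF]
  rw [P.onChart_pullSections, ← pullSections_app j l i d hd _ h1, hi, map_zero]
  rw [← pullSections_app j l i d hd _ h2] at ha
  exact (pullSections_bijective l _ h2 (by rw [hF, hl])).1 (ha.trans (map_zero _).symm)

end OnChart

end Sections

/-! ### Charts of `X` and of `X × X`, and how `F`, restriction and the diagonal act on them -/

section Charts

open TensorProduct

variable (k : Type u) [Field k] {n : ℕ} (S : Fan n)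

instance (σ : S.cones) : IsOpenImmersion (chart k S σ) :=
  inferInstanceAs (IsOpenImmersion (colimit.ι (chartFunctor k S) σ))

/-- Within a chart `U_τ`, a face chart is the locus `D(x^m)`, and `F^#(x^m) = (x^m)^q` vanishes at a
point exactly when `x^m` does. So a point of `U_τ` that `F` sends into a common face chart of `U_σ`
and `U_τ` already lies in that face chart. -/
lemma frob_preimage_chart {q : ℕ} (hq : q ≠ 0) (σ : S.cones) :
    frob k S q ⁻¹ᵁ (chart k S σ ''ᵁ ⊤) = chart k S σ ''ᵁ ⊤ := by
  rw [Scheme.Hom.image_top_eq_opensRange]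
  ext x
  change frob k S q x ∈ Set.range (chart k S σ) ↔ x ∈ Set.range (chart k S σ)
  have hfrob (τ : S.cones) (z) : frob k S q (chart k S τ z) =
      chart k S τ (Spec.map (CommRingCat.ofHom (powerMap k q τ.1)) z) := by
    rw [← Scheme.Hom.comp_apply, chart_frob, Scheme.Hom.comp_apply]
  constructor
  · rintro ⟨y, hy⟩
    obtain ⟨τ, z, rfl⟩ := Scheme.IsLocallyDirected.ι_jointly_surjective (chartFunctor k S) x
    have h1 := hy.trans (hfrob τ z)
    -- The image point lies in both `U_σ` and `U_τ`, so it comes from the chart of a cone `ρ`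
    -- contained in both.
    obtain ⟨ρ, f, g, p, hp, hp'⟩ := (Scheme.IsLocallyDirected.ι_eq_ι_iff (chartFunctor k S)).1 h1
    obtain ⟨m, hm, hτ⟩ := S.isFace_of_le ρ.2 τ.2 (leOfHom g)
    have hrange := (isOpenImmersion_and_range k (S.rational _ τ.2) hm hτ (leOfHom g)).2
    have hmem : Spec.map (CommRingCat.ofHom (powerMap k q τ.1)) z ∈ PrimeSpectrum.basicOpen
        (AddMonoidAlgebra.single (⟨m, hm⟩ : dualMonoid τ.1) (1 : k) : coneRing k τ.1) :=
      hrange.le ⟨p, hp'⟩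
    have hz : z ∈ Set.range ((chartFunctor k S).map g) := by
      refine hrange.ge ?_
      intro hz
      refine hmem ?_
      change powerMap k q τ.1 _ ∈ z.asIdeal
      have : powerMap k q τ.1 (AddMonoidAlgebra.single (⟨m, hm⟩ : dualMonoid τ.1) (1 : k)) =
          AddMonoidAlgebra.single (⟨m, hm⟩ : dualMonoid τ.1) (1 : k) ^ q := by
        rw [AddMonoidAlgebra.single_pow, one_pow]
        simp [powerMap]
      rw [this]
      exact Ideal.pow_mem_of_mem _ hz _ (Nat.pos_of_ne_zero hq)
    obtain ⟨y, rfl⟩ := hz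
    refine ⟨(chartFunctor k S).map f y, ?_⟩
    exact (Scheme.IsLocallyDirected.ι_eq_ι_iff (chartFunctor k S)).2 ⟨ρ, f, g, y, rfl, rfl⟩
  · rintro ⟨y, rfl⟩
    exact ⟨_, (hfrob σ y).symm⟩

/-- The open immersion `U_σ × U_τ → X × X`. -/
def prodChart (σ τ : S.cones) :
    Spec (CommRingCat.of (coneRing k σ.1 ⊗[k] coneRing k τ.1)) ⟶
      pullback (structureMap k S) (structureMap k S) :=
  (pullbackSpecIso k (coneRing k σ.1) (coneRing k τ.1)).inv ≫
    pullback.map _ _ _ _ (chart k S σ) (chart k S τ) (𝟙 _)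
      (by rw [chart_structureMap, Category.comp_id])
      (by rw [chart_structureMap, Category.comp_id])

instance (σ τ : S.cones) : IsOpenImmersion (prodChart k S σ τ) := by
  unfold prodChart
  infer_instance

lemma prodChart_fst (σ τ : S.cones) :
    prodChart k S σ τ ≫ pullback.fst _ _ =
      Spec.map (CommRingCat.ofHom Algebra.TensorProduct.includeLeftRingHom) ≫ chart k S σ := by
  rw [prodChart, Category.assoc, pullback.lift_fst, pullbackSpecIso_inv_fst_assoc]

lemma prodChart_snd (σ τ : S.cones) :
    prodChart k S σ τ ≫ pullback.snd _ _ =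
      Spec.map (CommRingCat.ofHom (AlgHom.toRingHom
        (Algebra.TensorProduct.includeRight : coneRing k τ.1 →ₐ[k] _))) ≫ chart k S τ := by
  rw [prodChart, Category.assoc, pullback.lift_snd, pullbackSpecIso_inv_snd_assoc]
  rfl

lemma prodChart_image (σ τ : S.cones) :
    prodChart k S σ τ ''ᵁ ⊤ =
      pullback.fst (structureMap k S) (structureMap k S) ⁻¹ᵁ (chart k S σ ''ᵁ ⊤) ⊓
        pullback.snd (structureMap k S) (structureMap k S) ⁻¹ᵁ (chart k S τ ''ᵁ ⊤) := by
  simp only [Scheme.Hom.image_top_eq_opensRange]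
  refine TopologicalSpace.Opens.ext ?_
  have h := Scheme.Pullback.range_map
    (f := Spec.map (CommRingCat.ofHom (algebraMap k (coneRing k σ.1))))
    (g := Spec.map (CommRingCat.ofHom (algebraMap k (coneRing k τ.1))))
    (structureMap k S) (structureMap k S) (chart k S σ) (chart k S τ) (𝟙 _)
      (by rw [chart_structureMap, Category.comp_id])
      (by rw [chart_structureMap, Category.comp_id])
  refine Eq.trans ?_ h
  change Set.range (prodChart k S σ τ) = _
  ext x
  constructor
  · rintro ⟨y, rfl⟩
    exact ⟨_, rfl⟩
  · rintro ⟨y, rfl⟩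
    exact ⟨(pullbackSpecIso k (coneRing k σ.1) (coneRing k τ.1)).hom y, by
      rw [prodChart, ← Scheme.Hom.comp_apply, Iso.hom_inv_id_assoc]⟩

lemma frobProd_preimage_prodChart {q : ℕ} (hq : q ≠ 0) (σ τ : S.cones) :
    frobProd k S q ⁻¹ᵁ (prodChart k S σ τ ''ᵁ ⊤) = prodChart k S σ τ ''ᵁ ⊤ := by
  rw [prodChart_image, Scheme.Hom.preimage_inf, ← Scheme.Hom.comp_preimage,
    ← Scheme.Hom.comp_preimage, frobProd,
    pullback.lift_fst, pullback.lift_snd, Scheme.Hom.comp_preimage, Scheme.Hom.comp_preimage,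
    frob_preimage_chart k S hq, frob_preimage_chart k S hq]

lemma diagonal_preimage_prodChart (σ : S.cones) :
    pullback.diagonal (structureMap k S) ⁻¹ᵁ (prodChart k S σ σ ''ᵁ ⊤) = chart k S σ ''ᵁ ⊤ := by
  rw [prodChart_image, Scheme.Hom.preimage_inf, ← Scheme.Hom.comp_preimage,
    ← Scheme.Hom.comp_preimage, pullback.diagonal_fst, pullback.diagonal_snd,
    Scheme.Hom.id_preimage, inf_idem]

/-- `x^u ↦ x^(q u)` as a homomorphism of `k`-algebras. -/
def powerAlgHom (q : ℕ) (σ : PointedCone ℝ (Fin n → ℝ)) : coneRing k σ →ₐ[k] coneRing k σ :=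
  AddMonoidAlgebra.mapDomainAlgHom k k (nsmulAddMonoidHom q)

/-- The inclusion `k[σ^∨ ∩ M] → k[τ^∨ ∩ M]` as a homomorphism of `k`-algebras. -/
def coneAlgHom {σ τ : PointedCone ℝ (Fin n → ℝ)} (h : τ ≤ σ) : coneRing k σ →ₐ[k] coneRing k τ :=
  AddMonoidAlgebra.mapDomainAlgHom k k (AddSubmonoid.inclusion (dualMonoid_anti h))

lemma chart_comp {σ τ : S.cones} (h : τ.1 ≤ σ.1) :
    Spec.map (CommRingCat.ofHom (coneRingMap k h)) ≫ chart k S σ = chart k S τ :=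
  colimit.w (chartFunctor k S) (homOfLE h)

lemma prodChart_frobProd (q : ℕ) (σ τ : S.cones) :
    Spec.map (CommRingCat.ofHom (Algebra.TensorProduct.map (powerAlgHom k q σ.1)
      (powerAlgHom k q τ.1)).toRingHom) ≫ prodChart k S σ τ =
        prodChart k S σ τ ≫ frobProd k S q := by
  refine pullback.hom_ext ?_ ?_
  · rw [Category.assoc, Category.assoc, prodChart_fst, frobProd, pullback.lift_fst,
      ← Category.assoc (prodChart k S σ τ), prodChart_fst, Category.assoc, chart_frob,
      ← Spec.map_comp_assoc, ← Spec.map_comp_assoc, ← CommRingCat.ofHom_comp,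
      ← CommRingCat.ofHom_comp]
    congr 3
    refine RingHom.ext fun x => ?_
    change Algebra.TensorProduct.map _ _ (x ⊗ₜ 1) = powerAlgHom k q σ.1 x ⊗ₜ 1
    rw [Algebra.TensorProduct.map_tmul, map_one]
  · rw [Category.assoc, Category.assoc, prodChart_snd, frobProd, pullback.lift_snd,
      ← Category.assoc (prodChart k S σ τ), prodChart_snd, Category.assoc, chart_frob,
      ← Spec.map_comp_assoc, ← Spec.map_comp_assoc, ← CommRingCat.ofHom_comp,
      ← CommRingCat.ofHom_comp]
    congr 3
    refine RingHom.ext fun x => ?_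
    change Algebra.TensorProduct.map _ _ (1 ⊗ₜ x) = 1 ⊗ₜ powerAlgHom k q τ.1 x
    rw [Algebra.TensorProduct.map_tmul, map_one]

lemma prodChart_restrict {σ τ σ' τ' : S.cones} (h : σ'.1 ≤ σ.1) (h' : τ'.1 ≤ τ.1) :
    Spec.map (CommRingCat.ofHom (Algebra.TensorProduct.map (coneAlgHom k h)
      (coneAlgHom k h')).toRingHom) ≫ prodChart k S σ τ = prodChart k S σ' τ' := by
  refine pullback.hom_ext ?_ ?_
  · rw [Category.assoc, prodChart_fst, prodChart_fst, ← chart_comp k S h, ← Spec.map_comp_assoc,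
      ← Spec.map_comp_assoc, ← CommRingCat.ofHom_comp, ← CommRingCat.ofHom_comp]
    congr 3
    refine RingHom.ext fun x => ?_
    change Algebra.TensorProduct.map _ _ (x ⊗ₜ 1) = coneAlgHom k h x ⊗ₜ 1
    rw [Algebra.TensorProduct.map_tmul, map_one]
  · rw [Category.assoc, prodChart_snd, prodChart_snd, ← chart_comp k S h', ← Spec.map_comp_assoc,
      ← Spec.map_comp_assoc, ← CommRingCat.ofHom_comp, ← CommRingCat.ofHom_comp]
    congr 3
    refine RingHom.ext fun x => ?_
    change Algebra.TensorProduct.map _ _ (1 ⊗ₜ x) = 1 ⊗ₜ coneAlgHom k h' x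
    rw [Algebra.TensorProduct.map_tmul, map_one]

lemma prodChart_diagonal (σ : S.cones) :
    Spec.map (CommRingCat.ofHom (Algebra.TensorProduct.lmul' k
      (S := coneRing k σ.1)).toRingHom) ≫ prodChart k S σ σ =
        chart k S σ ≫ pullback.diagonal (structureMap k S) := by
  refine pullback.hom_ext ?_ ?_
  · rw [Category.assoc, Category.assoc, prodChart_fst, pullback.diagonal_fst, Category.comp_id,
      ← Spec.map_comp_assoc, ← CommRingCat.ofHom_comp]
    refine Eq.trans ?_ (Category.id_comp _)
    rw [← Spec.map_id, ← CommRingCat.ofHom_id]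
    congr 3
    refine RingHom.ext fun x => ?_
    change Algebra.TensorProduct.lmul' k (x ⊗ₜ 1) = x
    rw [Algebra.TensorProduct.lmul'_apply_tmul, mul_one]
  · rw [Category.assoc, Category.assoc, prodChart_snd, pullback.diagonal_snd, Category.comp_id,
      ← Spec.map_comp_assoc, ← CommRingCat.ofHom_comp]
    refine Eq.trans ?_ (Category.id_comp _)
    rw [← Spec.map_id, ← CommRingCat.ofHom_id]
    congr 3
    refine RingHom.ext fun x => ?_
    change Algebra.TensorProduct.lmul' k (1 ⊗ₜ x) = x
    rw [Algebra.TensorProduct.lmul'_apply_tmul, one_mul]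

/-! ### Laurent polynomials -/

/-- The monomial `x^m ⊗ x^m'`. -/
def tensorMonomial {σ τ : PointedCone ℝ (Fin n → ℝ)} (m : dualMonoid σ) (m' : dualMonoid τ) :
    coneRing k σ ⊗[k] coneRing k τ :=
  AddMonoidAlgebra.single m 1 ⊗ₜ AddMonoidAlgebra.single m' 1

/-- The inclusion of `k[σ^∨ ∩ M] ⊗ k[τ^∨ ∩ M]` into the Laurent polynomial ring `k[M × M]`. -/
def toLaurent (σ τ : PointedCone ℝ (Fin n → ℝ)) :
    coneRing k σ ⊗[k] coneRing k τ →ₐ[k] AddMonoidAlgebra k ((Fin n → ℤ) × (Fin n → ℤ)) :=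
  Algebra.TensorProduct.productMap
    (AddMonoidAlgebra.mapDomainAlgHom k k
      ((AddMonoidHom.inl (Fin n → ℤ) (Fin n → ℤ)).comp (dualMonoid σ).subtype))
    (AddMonoidAlgebra.mapDomainAlgHom k k
      ((AddMonoidHom.inr (Fin n → ℤ) (Fin n → ℤ)).comp (dualMonoid τ).subtype))

lemma toLaurent_single {σ τ : PointedCone ℝ (Fin n → ℝ)} (m : dualMonoid σ) (m' : dualMonoid τ)
    (a b : k) :
    toLaurent k σ τ (AddMonoidAlgebra.single m a ⊗ₜ AddMonoidAlgebra.single m' b) =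
      AddMonoidAlgebra.single (m.1, m'.1) (a * b) := by
  simp [toLaurent, AddMonoidAlgebra.single_mul_single]

lemma coneTensor_induction {σ τ : PointedCone ℝ (Fin n → ℝ)}
    {p : coneRing k σ ⊗[k] coneRing k τ → Prop} (h0 : p 0) (hadd : ∀ x y, p x → p y → p (x + y))
    (hs : ∀ m m' a b, p (AddMonoidAlgebra.single m a ⊗ₜ AddMonoidAlgebra.single m' b)) (x) :
    p x := by
  induction x using TensorProduct.induction_on with
  | zero => exact h0
  | add x y hx hy => exact hadd x y hx hy
  | tmul x y =>
    induction x using AddMonoidAlgebra.induction_linear with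
    | zero => simpa using h0
    | add x x' hx hx' =>
      rw [TensorProduct.add_tmul]
      exact hadd _ _ hx hx'
    | single m a =>
      induction y using AddMonoidAlgebra.induction_linear with
      | zero => simpa using h0
      | add y y' hy hy' =>
        rw [TensorProduct.tmul_add]
        exact hadd _ _ hy hy'
      | single m' b => exact hs m m' a b

/-- This is how regularity on `U_σ × U_τ` is read off: every exponent that occurs lies in `σ^∨ ×
τ^∨`. -/
lemma mem_of_coeff_toLaurent_ne_zero {σ τ : PointedCone ℝ (Fin n → ℝ)}
    (x : coneRing k σ ⊗[k] coneRing k τ) (u : (Fin n → ℤ) × (Fin n → ℤ))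
    (hu : (toLaurent k σ τ x).coeff u ≠ 0) : u.1 ∈ dualMonoid σ ∧ u.2 ∈ dualMonoid τ := by
  induction x using coneTensor_induction k with
  | h0 => simp at hu
  | hadd x y hx hy =>
    by_cases h : (toLaurent k σ τ x).coeff u = 0
    · refine hy fun h' => hu ?_
      rw [map_add, AddMonoidAlgebra.coeff_add, Finsupp.add_apply, h, h', add_zero]
    · exact hx h
  | hs m m' a b =>
    rw [toLaurent_single, AddMonoidAlgebra.coeff_single, Finsupp.single_apply] at hu
    obtain rfl : (m.1, m'.1) = u := by
      by_contra h
      exact hu (if_neg h)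
    exact ⟨m.2, m'.2⟩

lemma toLaurent_coneAlgHom {σ τ σ' τ' : PointedCone ℝ (Fin n → ℝ)} (h : σ' ≤ σ) (h' : τ' ≤ τ)
    (x : coneRing k σ ⊗[k] coneRing k τ) :
    toLaurent k σ' τ' (Algebra.TensorProduct.map (coneAlgHom k h) (coneAlgHom k h') x) =
      toLaurent k σ τ x := by
  induction x using coneTensor_induction k with
  | h0 => simp
  | hadd x y hx hy => simp [hx, hy]
  | hs m m' a b =>
    rw [Algebra.TensorProduct.map_tmul, toLaurent_single]
    simp [coneAlgHom, toLaurent_single]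

/-- Restriction to the diagonal adds the two exponents, so a monomial contributes to the constant
term only if its exponent is of the form `(m, -m)`. -/
lemma mapDomain_toLaurent (σ : PointedCone ℝ (Fin n → ℝ)) (x : coneRing k σ ⊗[k] coneRing k σ) :
    AddMonoidAlgebra.mapDomain (fun u : (Fin n → ℤ) × (Fin n → ℤ) => u.1 + u.2)
        (toLaurent k σ σ x) =
      AddMonoidAlgebra.mapDomain Subtype.val (Algebra.TensorProduct.lmul' k x) := by
  induction x using coneTensor_induction k with
  | h0 => simp
  | hadd x y hx hy =>
    rw [map_add, map_add, AddMonoidAlgebra.mapDomain_add, AddMonoidAlgebra.mapDomain_add, hx, hy]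
  | hs m m' a b =>
    rw [toLaurent_single]
    simp [AddMonoidAlgebra.single_mul_single]

lemma mem_dualMonoid_bot (m : Fin n → ℤ) :
    m ∈ dualMonoid (⊥ : PointedCone ℝ (Fin n → ℝ)) := by
  intro x hx
  rw [(Submodule.mem_bot _).1 hx]
  simp [pairing]

lemma map_powerAlgHom_tensorMonomial (q : ℕ) {σ τ : PointedCone ℝ (Fin n → ℝ)} (m : dualMonoid σ)
    (m' : dualMonoid τ) :
    Algebra.TensorProduct.map (powerAlgHom k q σ) (powerAlgHom k q τ) (tensorMonomial k m m') =
      tensorMonomial k (q • m) (q • m') := by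
  rw [tensorMonomial, Algebra.TensorProduct.map_tmul]
  simp [powerAlgHom, tensorMonomial]

lemma tensorMonomial_mul {σ τ : PointedCone ℝ (Fin n → ℝ)} (m l : dualMonoid σ)
    (m' l' : dualMonoid τ) :
    tensorMonomial k m m' * tensorMonomial k l l' = tensorMonomial k (m + l) (m' + l') := by
  simp [tensorMonomial, AddMonoidAlgebra.single_mul_single]

lemma map_coneAlgHom_tensorMonomial {σ τ σ' τ' : PointedCone ℝ (Fin n → ℝ)} (h : σ' ≤ σ)
    (h' : τ' ≤ τ) (m : dualMonoid σ) (m' : dualMonoid τ) :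
    Algebra.TensorProduct.map (coneAlgHom k h) (coneAlgHom k h') (tensorMonomial k m m') =
      tensorMonomial k (AddSubmonoid.inclusion (dualMonoid_anti h) m)
        (AddSubmonoid.inclusion (dualMonoid_anti h') m') := by
  rw [tensorMonomial, Algebra.TensorProduct.map_tmul]
  simp [coneAlgHom, tensorMonomial]

/-- If `X(Σ)` is diagonally split at `q`, every class of `M` modulo `q` has a representative
`w - q m` that is small along all rays: this is expressed by the regularity on all charts
`U_σ × U_σ` of one monomial `x^(m, -m)` of the splitting. -/
theorem IsDiagonallySplit.exists_forall_mem_dualMonoid {q : ℕ} (hq : q ≠ 0)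
    (h : IsDiagonallySplit k S q) (hbot : ⊥ ∈ S.cones) (w : Fin n → ℤ) :
    ∃ m : Fin n → ℤ, ∀ σ ∈ S.cones, ∀ t t' : Fin n → ℤ, w + q • t ∈ dualMonoid σ →
      -w + q • t' ∈ dualMonoid σ → m + t ∈ dualMonoid σ ∧ -m + t' ∈ dualMonoid σ := by
  obtain ⟨P, hP⟩ := h
  -- The zero cone gives the torus, where `x^(w,-w)` is regular for every `w`.
  let o : S.cones := ⟨⊥, hbot⟩
  let el (m : Fin n → ℤ) : dualMonoid o.1 := ⟨m, mem_dualMonoid_bot m⟩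
  let π (σ : S.cones) := P.onChart (prodChart k S σ σ) (frobProd_preimage_prodChart k S hq σ σ)
  let f := π o (tensorMonomial k (el w) (el (-w)))
  have hsum : Algebra.TensorProduct.lmul' k f = (1 : coneRing k o.1) := by
    have hone : tensorMonomial k (el 0) (el 0) = 1 := rfl
    have h0 := P.onChart_compatible (prodChart k S o o) (frobProd_preimage_prodChart k S hq o o)
      _ hP (chart k S o) _ (prodChart_diagonal k S o) (diagonal_preimage_prodChart k S o)
      (tensorMonomial k (el w) (el (-w)) - 1) (by
        change Algebra.TensorProduct.lmul' k (tensorMonomial k (el w) (el (-w)) - 1) = 0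
        rw [map_sub, map_one, sub_eq_zero, tensorMonomial, Algebra.TensorProduct.lmul'_apply_tmul,
          AddMonoidAlgebra.single_mul_single, AddMonoidAlgebra.one_def, one_mul]
        congr 1
        exact Subtype.ext (add_neg_cancel w))
    have h1 := P.onChart_one (prodChart k S o o) (frobProd_preimage_prodChart k S hq o o)
    rw [map_sub] at h0
    erw [h1] at h0
    exact sub_eq_zero.1 (((Algebra.TensorProduct.lmul' k).map_sub f 1).symm.trans h0) |>.trans
      (map_one _)
  -- The constant term of the restriction of `f` to the diagonal is `1`, so some exponent of `f` has
  -- components summing to zero.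
  obtain ⟨u, hu, hu0⟩ : ∃ u, (toLaurent k o.1 o.1 f).coeff u ≠ 0 ∧ u.1 + u.2 = 0 := by
    have h1 := congr(($(mapDomain_toLaurent k o.1 f)).coeff 0)
    rw [hsum, AddMonoidAlgebra.one_def, AddMonoidAlgebra.mapDomain_single,
      AddMonoidAlgebra.coeff_single, ZeroMemClass.coe_zero, Finsupp.single_eq_same] at h1
    by_contra! hcon
    refine one_ne_zero (h1.symm.trans (Finsupp.notMem_support_iff.1 fun h2 => ?_))
    obtain ⟨u, hu, hu0⟩ := Finset.mem_image.1 (Finsupp.mapDomain_support h2)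
    exact hcon u (Finsupp.mem_support_iff.1 hu) hu0
  refine ⟨u.1, fun σ hσ t t' ht ht' => ?_⟩
  let s : S.cones := ⟨σ, hσ⟩
  have hle : o.1 ≤ s.1 := bot_le
  have h1 := P.onChart_restrict (prodChart k S o o) (frobProd_preimage_prodChart k S hq o o)
    (prodChart k S s s) (frobProd_preimage_prodChart k S hq s s) _ (prodChart_restrict k S hle hle)
    (tensorMonomial k ⟨_, ht⟩ ⟨_, ht'⟩)
  have h2 := P.onChart_mul (prodChart k S o o) (frobProd_preimage_prodChart k S hq o o) _
    (prodChart_frobProd k S q o o) (tensorMonomial k (el t) (el t'))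
    (tensorMonomial k (el w) (el (-w)))
  have h3 : Algebra.TensorProduct.map (powerAlgHom k q o.1) (powerAlgHom k q o.1)
      (tensorMonomial k (el t) (el t')) * tensorMonomial k (el w) (el (-w)) =
      Algebra.TensorProduct.map (coneAlgHom k hle) (coneAlgHom k hle)
        (tensorMonomial k ⟨_, ht⟩ ⟨_, ht'⟩) := by
    rw [map_powerAlgHom_tensorMonomial, map_coneAlgHom_tensorMonomial, tensorMonomial_mul]
    congr 1
    · exact Subtype.ext (add_comm _ _)
    · exact Subtype.ext (add_comm _ _)
  have h4 : tensorMonomial k (el t) (el t') * f =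
      Algebra.TensorProduct.map (coneAlgHom k hle) (coneAlgHom k hle)
        (π s (tensorMonomial k ⟨_, ht⟩ ⟨_, ht'⟩)) :=
    h2.symm.trans ((congrArg (π o) h3).trans h1)
  -- The coefficient of `x^(t,t') f` at `(t,t') + u` is that of `f` at `u`, which is nonzero.
  have h5 := congr((toLaurent k o.1 o.1 $h4).coeff ((t, t') + u))
  rw [toLaurent_coneAlgHom, map_mul, tensorMonomial, toLaurent_single] at h5
  have h6 : (toLaurent k s.1 s.1 (π s (tensorMonomial k ⟨_, ht⟩ ⟨_, ht'⟩))).coeff ((t, t') + u) ≠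
      0 := by
    rw [← h5]
    refine fun h => hu (Eq.trans ?_ h)
    rw [one_mul]
    exact ((AddMonoidAlgebra.coeff_single_mul_add _ _ _ _).trans (one_mul _)).symm
  have h7 := mem_of_coeff_toLaurent_ne_zero k _ _ h6
  have h8 : u.2 = -u.1 := (neg_eq_of_add_eq_zero_right hu0).symm
  rw [← h8, add_comm, add_comm u.2]
  exact h7

end Charts

end

/-! ### Two-regularity of the configuration -/

/-- The vectors of `configuration` as a family. -/
def configVec : Fin 7 → Fin 4 → ℤ :=
  ![![1, 0, 0, 0], ![0, 1, 0, 0], ![0, 0, 1, 1], ![0, 0, 1, -1],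
    ![1, 1, -1, 0], ![1, -1, 1, 0], ![-1, 1, 1, 0]]

lemma mem_configuration_iff (v : Fin 4 → ℤ) : v ∈ configuration ↔ ∃ i, configVec i = v := by
  simp only [configuration, configVec, Set.mem_insert_iff, Set.mem_singleton_iff,
    Fin.exists_fin_succ, eq_comm (b := v)]
  simp

/-- The cofactors of an integral `4 × 4` matrix, in a form that the kernel evaluates quickly. -/
def cofactor (M : Matrix (Fin 4) (Fin 4) ℤ) (i j : Fin 4) : ℤ :=
  let N := M.submatrix i.succAbove j.succAbove
  (-1) ^ (i + j : ℕ) * (N 0 0 * N 1 1 * N 2 2 - N 0 0 * N 1 2 * N 2 1 - N 0 1 * N 1 0 * N 2 2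
    + N 0 1 * N 1 2 * N 2 0 + N 0 2 * N 1 0 * N 2 1 - N 0 2 * N 1 1 * N 2 0)

/-- The determinant of an integral `4 × 4` matrix, expanded along the first row. -/
def cofactorDet (M : Matrix (Fin 4) (Fin 4) ℤ) : ℤ :=
  M 0 0 * cofactor M 0 0 + M 0 1 * cofactor M 0 1 + M 0 2 * cofactor M 0 2 + M 0 3 * cofactor M 0 3

lemma adjugate_eq_cofactor (M : Matrix (Fin 4) (Fin 4) ℤ) (i j : Fin 4) :
    M.adjugate i j = cofactor M j i := by
  rw [Matrix.adjugate_fin_succ_eq_det_submatrix, Matrix.det_fin_three]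
  rfl

lemma det_eq_cofactorDet (M : Matrix (Fin 4) (Fin 4) ℤ) : M.det = cofactorDet M := by
  have h := congr_fun₂ (Matrix.mul_adjugate M) 0 0
  rw [Matrix.mul_apply, Fin.sum_univ_four] at h
  simp only [adjugate_eq_cofactor] at h
  simpa [cofactorDet] using h.symm

/-- Integrality of `2 adj(M) / det M` for every independent quadruple, a finite check. Increasing
indices suffice, as reordering the rows does not change their span. -/
lemma cofactorDet_dvd_configVec : ∀ a b : Fin 7, a < b → ∀ c, b < c → ∀ d, c < d →
    cofactorDet ![configVec a, configVec b, configVec c, configVec d] = 0 ∨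
      ∀ i j, cofactorDet ![configVec a, configVec b, configVec c, configVec d] ∣
        2 * cofactor ![configVec a, configVec b, configVec c, configVec d] i j := by
  decide +kernel

lemma two_smul_mem_span_configVec {c : Fin 4 → Fin 7} (hc : StrictMono c)
    (hdet : (Matrix.of (configVec ∘ c)).det ≠ 0) (x : Fin 4 → ℤ) :
    2 • x ∈ Submodule.span ℤ (Set.range (configVec ∘ c)) := by
  have hM : (![configVec (c 0), configVec (c 1), configVec (c 2), configVec (c 3)] :
      Matrix (Fin 4) (Fin 4) ℤ) = Matrix.of (configVec ∘ c) := by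
    ext i j
    fin_cases i <;> rfl
  have hdvd := cofactorDet_dvd_configVec (c 0) (c 1) (hc (by decide)) (c 2) (hc (by decide)) (c 3)
    (hc (by decide))
  rw [hM, ← det_eq_cofactorDet] at hdvd
  generalize hMM : Matrix.of (configVec ∘ c) = M at *
  choose C hC using hdvd.resolve_left hdet
  -- `C` transposed is the integral matrix `2 M⁻¹`; the identity is obtained by cancelling `det M`.
  -- The coefficients of `2x` in the rows of `M` are then the entries of the row vector `x · 2 M⁻¹`.
  have hmul : (Matrix.of fun i j => C j i) * M = (2 : ℤ) • (1 : Matrix (Fin 4) (Fin 4) ℤ) := by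
    have h1 : M.det • ((Matrix.of fun i j => C j i) * M) =
        M.det • ((2 : ℤ) • (1 : Matrix (Fin 4) (Fin 4) ℤ)) := by
      have h2 : M.det • (Matrix.of fun i j => C j i) = (2 : ℤ) • M.adjugate := by
        ext i j
        simp [adjugate_eq_cofactor, hC]
      rw [← Matrix.smul_mul, h2, Matrix.smul_mul, Matrix.adjugate_mul, smul_comm]
    exact smul_right_injective _ hdet h1
  have hx : 2 • x = ∑ i, Matrix.vecMul x (Matrix.of fun i j => C j i) i • configVec (c i) := by
    have h3 : Matrix.vecMul (Matrix.vecMul x (Matrix.of fun i j => C j i)) M = 2 • x := by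
      rw [Matrix.vecMul_vecMul, hmul, Matrix.vecMul_smul, Matrix.vecMul_one]
      simp
    rw [← h3, Matrix.vecMul_eq_sum, ← hMM]
    rfl
  rw [hx]
  exact Submodule.sum_mem _ fun i _ =>
    Submodule.smul_mem _ _ (Submodule.subset_span ⟨i, rfl⟩)

/-- If no nonzero multiple of `v` lay in the span, adjoining `v` would keep `B` independent, against
maximality. -/
lemma exists_ne_zero_smul_mem_of_maximal {n : ℕ} {A B : Set (Fin n → ℤ)}
    (hB : Maximal (fun C => C ⊆ A ∧ LinearIndepOn ℤ id C) B) {v : Fin n → ℤ} (hv : v ∈ A) :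
    ∃ r : ℤ, r ≠ 0 ∧ r • v ∈ Submodule.span ℤ B := by
  by_contra! h
  have hins := hB.prop.2.id_insert' (x := v) fun r hr => by
    by_contra hr0
    exact h r hr0 hr
  have := hB.le_of_ge ⟨Set.insert_subset hv hB.prop.1, hins⟩ (Set.subset_insert _ _)
  exact h 1 one_ne_zero (Submodule.smul_mem _ _ (Submodule.subset_span (this (Set.mem_insert _ _))))

/-- The saturation `T` of `⟨B⟩` contains `A` by maximality. As `⟨A⟩` contains `dN`, the quotient `N
/ ⟨B⟩` is torsion, so `⟨B⟩` has full rank. -/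
lemma finrank_span_eq_of_maximal {n : ℕ} {A B : Set (Fin n → ℤ)}
    (hB : Maximal (fun C => C ⊆ A ∧ LinearIndepOn ℤ id C) B) {d : ℤ} (hd : d ≠ 0)
    (hA : ∀ x : Fin n → ℤ, d • x ∈ Submodule.span ℤ A) :
    Module.finrank ℤ (Submodule.span ℤ B) = n := by
  let T : Submodule ℤ (Fin n → ℤ) :=
    (Submodule.torsion ℤ ((Fin n → ℤ) ⧸ Submodule.span ℤ B)).comap (Submodule.span ℤ B).mkQ
  have hT (x : Fin n → ℤ) : x ∈ T ↔ ∃ r : ℤ, r ≠ 0 ∧ r • x ∈ Submodule.span ℤ B := by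
    rw [Submodule.mem_comap, Submodule.mem_torsion_iff]
    constructor
    · rintro ⟨r, hr⟩
      change (r : ℤ) • (Submodule.span ℤ B).mkQ x = 0 at hr
      rw [← map_smul, Submodule.mkQ_apply, Submodule.Quotient.mk_eq_zero] at hr
      exact ⟨r, nonZeroDivisors.ne_zero r.2, hr⟩
    · rintro ⟨r, hr, hrx⟩
      refine ⟨⟨r, mem_nonZeroDivisors_of_ne_zero hr⟩, ?_⟩
      change r • (Submodule.span ℤ B).mkQ x = 0
      rwa [← map_smul, Submodule.mkQ_apply, Submodule.Quotient.mk_eq_zero]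
  have hAT : Submodule.span ℤ A ≤ T :=
    Submodule.span_le.2 fun v hv => (hT v).2 (exists_ne_zero_smul_mem_of_maximal hB hv)
  have htors : Module.IsTorsion ℤ ((Fin n → ℤ) ⧸ Submodule.span ℤ B) := by
    intro x
    obtain ⟨x, rfl⟩ := Submodule.mkQ_surjective _ x
    obtain ⟨r, hr, hrx⟩ := (hT _).1 (hAT (hA x))
    refine ⟨⟨r * d, mem_nonZeroDivisors_of_ne_zero (mul_ne_zero hr hd)⟩, ?_⟩
    change (r * d) • (Submodule.span ℤ B).mkQ x = 0
    rw [← map_smul, Submodule.mkQ_apply, Submodule.Quotient.mk_eq_zero, mul_smul]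
    exact hrx
  have h := Submodule.finrank_quotient_add_finrank (Submodule.span ℤ B)
  rw [htors.finrank_eq_zero, zero_add, Module.finrank_fin_fun] at h
  exact h

theorem isKRegular_two {A : Set (Fin 4 → ℤ)}
    (hA : ∀ v ∈ A, v ∈ configuration ∨ -v ∈ configuration)
    (hconf : ∀ v ∈ configuration, v ∈ A ∨ -v ∈ A) : IsKRegular 2 A := by
  intro B hB x
  obtain ⟨x, rfl⟩ := Submodule.mkQ_surjective _ x
  rw [← map_nsmul, Submodule.mkQ_apply, Submodule.Quotient.mk_eq_zero]
  have hspan (i : Fin 7) : configVec i ∈ Submodule.span ℤ A := by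
    obtain h | h := hconf _ ((mem_configuration_iff _).2 ⟨i, rfl⟩)
    · exact Submodule.subset_span h
    · exact (Submodule.neg_mem_iff _).1 (Submodule.subset_span h)
  have hA2 (x : Fin 4 → ℤ) : (2 : ℤ) • x ∈ Submodule.span ℤ A := by
    -- `2e₃` and `2e₄` are the sum and the difference of `e₃ + e₄` and `e₃ - e₄`.
    have hx : (2 : ℤ) • x = (2 * x 0) • configVec 0 + (2 * x 1) • configVec 1 +
        (x 2 + x 3) • configVec 2 + (x 2 - x 3) • configVec 3 := by
      ext j
      fin_cases j <;> simp [configVec] <;> ring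
    rw [hx]
    exact add_mem (add_mem (add_mem (Submodule.smul_mem _ _ (hspan 0))
      (Submodule.smul_mem _ _ (hspan 1))) (Submodule.smul_mem _ _ (hspan 2)))
      (Submodule.smul_mem _ _ (hspan 3))
  have hrank := finrank_span_eq_of_maximal hB two_ne_zero hA2
  have hfin : B.Finite := hB.prop.2.setFinite
  have := hfin.fintype
  rw [finrank_span_set_eq_card hB.prop.2, Set.toFinset_card] at hrank
  let e₀ : Fin 4 ≃ B := (Fintype.equivFinOfCardEq hrank).symm
  have hsign (j : Fin 4) : ∃ (i : Fin 7) (s : ℤˣ), configVec i = s • (e₀ j : Fin 4 → ℤ) := by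
    obtain h | h := hA _ (hB.prop.1 (e₀ j).2)
    · obtain ⟨i, hi⟩ := (mem_configuration_iff _).1 h
      exact ⟨i, 1, by rw [hi, one_smul]⟩
    · obtain ⟨i, hi⟩ := (mem_configuration_iff _).1 h
      exact ⟨i, -1, by rw [hi, Units.neg_smul, one_smul]⟩
  choose c₀ s₀ hc₀ using hsign
  have hind₀ : LinearIndependent ℤ (configVec ∘ c₀) := by
    have h1 : LinearIndependent ℤ fun j => (e₀ j : Fin 4 → ℤ) :=
      LinearIndependent.comp hB.prop.2 e₀ e₀.injective
    have h2 := h1.units_smul s₀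
    convert h2 using 1
    exact funext fun j => hc₀ j
  have hinj : Function.Injective c₀ := fun a b hab => hind₀.injective (congrArg configVec hab)
  -- Sorting the indices brings the basis into the increasing form covered by the finite check.
  let c := c₀ ∘ Tuple.sort c₀
  have hc : StrictMono c :=
    (Tuple.monotone_sort c₀).strictMono_of_injective (hinj.comp (Tuple.sort c₀).injective)
  have hind : LinearIndependent ℤ (configVec ∘ c) := hind₀.comp _ (Tuple.sort c₀).injective
  have hdet : (Matrix.of (configVec ∘ c)).det ≠ 0 := by
    intro h
    obtain ⟨v, hv, hv0⟩ := Matrix.exists_vecMul_eq_zero_iff.2 h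
    rw [Matrix.vecMul_eq_sum] at hv0
    exact hv (funext (Fintype.linearIndependent_iff.1 hind v hv0))
  refine Submodule.span_le.2 ?_ (two_smul_mem_span_configVec hc hdet x)
  rintro _ ⟨j, rfl⟩
  change configVec (c₀ (Tuple.sort c₀ j)) ∈ Submodule.span ℤ B
  rw [hc₀]
  exact Submodule.smul_mem _ _ (Submodule.subset_span (e₀ _).2)

/-! ### The class without a small representative -/

lemma eq_zero_of_abs_mul_lt {q z : ℤ} (h1 : q * z < q) (h2 : -q < q * z) : z = 0 := by
  have hq : 0 < q := by linarith
  have h3 : z < 1 := by nlinarith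
  have h4 : -1 < z := by nlinarith
  omega

/-- For every `q ≥ 2` there is a class modulo `q` without representatives `u` such that
`|⟨u, v⟩| < q` for all `v` in the configuration. -/
lemma exists_class_without_small_representative {q : ℕ} (hq : 2 ≤ q) :
    ∃ w : Fin 4 → ℤ, ∀ m : Fin 4 → ℤ, ∃ i, (q : ℤ) ≤ |∑ j, (w j - q * m j) * configVec i j| := by
  obtain ⟨p, rfl | rfl⟩ := Nat.even_or_odd' q
  -- For `q = 2p` the pairings of `w - qm` with `e₃ + e₄` and `e₃ - e₄` are the multiples `q(1 - m 2
  -- - m 3)` and `q(m 3 - m 2)` of `q`. Both would have to vanish, but the two factors add up to the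
  -- odd number `1 - 2 m 2`.
  · refine ⟨![0, 0, p, p], fun m => ?_⟩
    by_contra! h
    have h2 := abs_lt.1 (h 2)
    have h3 := abs_lt.1 (h 3)
    simp [configVec, Fin.sum_univ_four] at h2 h3
    have e2 := eq_zero_of_abs_mul_lt (q := 2 * (p : ℤ)) (z := 1 - m 2 - m 3) (by linarith)
      (by linarith)
    have e3 := eq_zero_of_abs_mul_lt (q := 2 * (p : ℤ)) (z := m 3 - m 2) (by linarith)
      (by linarith)
    omega
  -- For `q = 2p + 1`, the vectors `e₃ ± e₄` force `m 2 = m 3 = 0`. Then `e₁ - e₂ + e₃` and `-e₁ +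
  -- e₂ + e₃` have pairings `1 ± q(m 1 - m 0)`, which force `m 0 = m 1`. Finally `e₁ + e₂ - e₃` has
  -- pairing `q(1 - 2 m 1)`, a nonzero multiple of `q`.
  · refine ⟨![p + 1, p + 1, 1, 1], fun m => ?_⟩
    by_contra! h
    have hp : (1 : ℤ) ≤ p := by omega
    have h2 := abs_lt.1 (h 2)
    have h3 := abs_lt.1 (h 3)
    have h4 := abs_lt.1 (h 4)
    have h5 := abs_lt.1 (h 5)
    have h6 := abs_lt.1 (h 6)
    simp [configVec, Fin.sum_univ_four] at h2 h3 h4 h5 h6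
    have e3 := eq_zero_of_abs_mul_lt (q := 2 * (p : ℤ) + 1) (z := m 3 - m 2) (by linarith)
      (by linarith)
    have e2 : m 2 = 0 := by
      have : m 3 = m 2 := by omega
      rw [this] at h2
      have h7 : m 2 < 1 := by nlinarith
      have h8 : -1 < m 2 := by nlinarith
      omega
    rw [e2] at h4 h5 h6
    have e1 : m 0 = m 1 := by
      have h7 : m 0 - m 1 < 1 := by nlinarith
      have h8 : -1 < m 0 - m 1 := by nlinarith
      omega
    rw [e1] at h4
    have e4 := eq_zero_of_abs_mul_lt (q := 2 * (p : ℤ) + 1) (z := 1 - 2 * m 1) (by linarith)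
      (by linarith)
    omega

/-! ### Rays -/

lemma mem_dualMonoid_ray {n : ℕ} (v m : Fin n → ℤ) :
    m ∈ dualMonoid (PointedCone.hull ℝ {toReal v}) ↔ 0 ≤ ∑ i, m i * v i := by
  constructor
  · intro h
    have h1 := h (toReal v) (Submodule.subset_span rfl)
    rw [pairing_toReal] at h1
    exact_mod_cast h1
  · rintro h
    refine mem_dualMonoid_hull _ _ ?_
    rintro _ rfl
    rw [pairing_toReal]
    exact_mod_cast h

lemma Fan.bot_mem_of_mem_rays {n : ℕ} {S : Fan n} {v : Fin n → ℤ} (hv : v ∈ S.rays) :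
    ⊥ ∈ S.cones := by
  -- The functional `v` itself cuts out the zero face of its ray, since `⟨v, v⟩` is a sum of
  -- squares.
  refine S.face_mem _ hv.2 _ ⟨v, ?_, fun x => ?_⟩
  · exact (mem_dualMonoid_ray v v).2 (Finset.sum_nonneg fun i _ => mul_self_nonneg _)
  · constructor
    · intro hx
      rw [(Submodule.mem_bot _).1 hx]
      exact ⟨zero_mem _, by simp [pairing]⟩
    · rintro ⟨hx, h0⟩
      obtain ⟨a, rfl⟩ := Submodule.mem_span_singleton.1 hx
      rw [Submodule.mem_bot]
      have h1 : a.1 * ∑ i, (v i : ℝ) * v i = 0 := by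
        refine Eq.trans ?_ h0
        rw [pairing, Finset.mul_sum]
        refine Finset.sum_congr rfl fun i _ => ?_
        change _ = (v i : ℝ) * (a.1 * v i)
        ring
      obtain h | h := mul_eq_zero.1 h1
      · have : a = 0 := Subtype.ext h
        rw [this, zero_smul]
      · have h2 : toReal v = 0 := funext fun i => by
          have := (Finset.sum_eq_zero_iff_of_nonneg fun i _ => mul_self_nonneg _).1 h i
            (Finset.mem_univ i)
          exact mul_self_eq_zero.1 this
        rw [h2, smul_zero]

/-- A diagonal splitting at `q` yields representatives `w - q m` of every class modulo `q` that
are small along all rays `v` taking the value `1` on some element of `M`. -/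
theorem IsDiagonallySplit.exists_forall_abs_lt {k : Type u} [Field k] {n : ℕ} {S : Fan n} {q : ℕ}
    (hq : q ≠ 0) (h : IsDiagonallySplit k S q) (hbot : ⊥ ∈ S.cones) (w : Fin n → ℤ) :
    ∃ m : Fin n → ℤ, ∀ v ∈ S.rays, (∃ t : Fin n → ℤ, ∑ i, t i * v i = 1) →
      |∑ i, (w i - q * m i) * v i| < q := by
  obtain ⟨m, hm⟩ := h.exists_forall_mem_dualMonoid k S hq hbot w
  refine ⟨m, fun v hv ⟨t, ht⟩ => ?_⟩
  let W := ∑ i, w i * v i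
  have hq' : (0 : ℤ) < q := by positivity
  have hlin (a b : Fin n → ℤ) (r s : ℤ) :
      ∑ i, (r • a + s • b) i * v i = r * ∑ i, a i * v i + s * ∑ i, b i * v i := by
    simp only [Finset.mul_sum, ← Finset.sum_add_distrib, Pi.add_apply, Pi.smul_apply, smul_eq_mul]
    exact Finset.sum_congr rfl fun i _ => by ring
  -- Since `⟨t, v⟩ = 1`, the shifted exponent pairs with `v` to the remainder of `εW` modulo `q`,
  -- the least nonnegative value in its class.
  have hreg (a : Fin n → ℤ) (ε : ℤ) (hε : a = ε • w) :
      a + q • (-((ε * W) / q) • t) ∈ dualMonoid (PointedCone.hull ℝ {toReal v}) := by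
    rw [mem_dualMonoid_ray, hε, ← natCast_zsmul, smul_smul, hlin, ht]
    have := Int.emod_nonneg (ε * W) hq'.ne'
    have := Int.emod_add_mul_ediv (ε * W) q
    change 0 ≤ ε * W + _
    linarith
  obtain ⟨h1, h2⟩ := hm _ hv.2 _ _ (hreg w 1 (one_smul _ _).symm)
    (hreg (-w) (-1) (by rw [neg_smul, one_smul]))
  rw [mem_dualMonoid_ray] at h1 h2
  have e1 := hlin m t 1 (-((1 * W) / q))
  have e2 := hlin m t (-1) (-((-1 * W) / q))
  rw [one_smul] at e1
  rw [neg_smul, one_smul] at e2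
  rw [e1, ht] at h1
  rw [e2, ht] at h2
  have e3 := hlin w m 1 (-q)
  have e4 : ∑ i, (w i - q * m i) * v i = W - q * ∑ i, m i * v i := by
    have : ∀ i, w i - q * m i = ((1 : ℤ) • w + (-q : ℤ) • m) i := fun i => by
      simp [sub_eq_add_neg]
    simp only [this, e3]
    ring
  rw [e4]
  -- Now `⌊W/q⌋ ≤ ⟨m, v⟩ ≤ -⌊-W/q⌋`, and both bounds differ from `W/q` by less than `1` because
  -- remainders are less than `q`.
  have l1 := Int.emod_lt_of_pos (1 * W) hq'
  have l2 := Int.emod_lt_of_pos (-1 * W) hq'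
  have d1 := Int.emod_add_mul_ediv (1 * W) q
  have d2 := Int.emod_add_mul_ediv (-1 * W) q
  rw [abs_lt]
  constructor
  · nlinarith
  · nlinarith

/-- Each of the seven vectors has a coordinate equal to `1`, so a coordinate functional serves. -/
lemma exists_pairing_configVec_eq_one (i : Fin 7) : ∃ t : Fin 4 → ℤ,
    ∑ j, t j * configVec i j = 1 := by
  refine ⟨![![1, 0, 0, 0], ![0, 1, 0, 0], ![0, 0, 1, 0], ![0, 0, 1, 0], ![1, 0, 0, 0],
    ![1, 0, 0, 0], ![0, 1, 0, 0]] i, ?_⟩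
  revert i
  decide

end ToricSplit

theorem mainTheorem11 (k : Type u) [Field k] (S : ToricSplit.Fan 4)
    (hrays : ∀ v ∈ S.rays,
      v ∈ ToricSplit.configuration ∨ -v ∈ ToricSplit.configuration)
    (hconf : ∀ v ∈ ToricSplit.configuration, v ∈ S.rays ∨ -v ∈ S.rays) :
    ToricSplit.IsKRegular 2 S.rays ∧
      ∀ q : ℕ, 2 ≤ q → ¬ ToricSplit.IsDiagonallySplit k S q := by
  refine ⟨ToricSplit.isKRegular_two hrays hconf, fun q hq h => ?_⟩
  have hconf' (i : Fin 7) :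
      ToricSplit.configVec i ∈ S.rays ∨ -ToricSplit.configVec i ∈ S.rays :=
    hconf _ ((ToricSplit.mem_configuration_iff _).2 ⟨i, rfl⟩)
  have hbot : ⊥ ∈ S.cones :=
    (hconf' 0).elim ToricSplit.Fan.bot_mem_of_mem_rays ToricSplit.Fan.bot_mem_of_mem_rays
  obtain ⟨w, hw⟩ := ToricSplit.exists_class_without_small_representative hq
  obtain ⟨m, hm⟩ := h.exists_forall_abs_lt (by omega) hbot w
  obtain ⟨i, hi⟩ := hw m
  obtain ⟨t, ht⟩ := ToricSplit.exists_pairing_configVec_eq_one i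
  refine hi.not_gt ?_
  obtain hv | hv := hconf' i
  · exact hm _ hv ⟨t, ht⟩
  -- Replacing the vector by its negative changes only the sign inside the absolute value.
  · have := hm _ hv ⟨-t, by simpa using ht⟩
    simpa using this
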